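/- For a metrizable space $X$, let $C_b(X)$ be the C*-algebra of bounded continuous functions $f\colon X\to\mathbb{C}$ with the supremum norm, and let $$C_s(X)=\{f\in C_b(X): \operatorname{supp}(f)=\overline{\{x\in X: f(x)\neq 0\}}\ \text{is separable}\},$$ which is a closed $*$-subalgebra of $C_b(X)$ and hence a (possibly non-unital) commutative C*-algebra. Its spectrum is the set of all characters (non-zero continuous algebra homomorphisms $C_s(X)\to\mathbb{C}$) with the weak$^*$ topology. Let $\beta X$ be the Stone–Čech compactification of $X$. A cozero-set of $X$ is a set of the form $\{x\in X: f(x)\ne 0\}$ with $f\in C_b(X)$. Put $$\lambda X=\bigcup\{\operatorname{int}_{\beta X}\operatorname{cl}_{\beta X} C : C\subseteq X \text{ a separable cozero-set of } X\}\subseteq\beta X$$ with the subspace topology. **Theorem.** Let $X$ be a metrizable space that is locally separable (every point has a separable open neighbourhood) and not separable. Then the spectrum of $C_s(X)$ is homeomorphic to $\lambda X$; it is locally compact, countably compact and non-normal. -/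

import Mathlib

open scoped BoundedContinuousFunction

/-- The subspace `s` of a metrizable space is separable iff it is contained in the closure of a
countable set. -/
theorem separableSpace_coe_iff_isSeparable {X : Type*} [TopologicalSpace X]
    [TopologicalSpace.MetrizableSpace X] (s : Set X) :
    TopologicalSpace.SeparableSpace s ↔ TopologicalSpace.IsSeparable s :=
  ⟨fun _ => TopologicalSpace.IsSeparable.of_subtype s, fun h => h.separableSpace⟩

/-- The support `closure {x | f x ≠ 0}` of a function on a metrizable space is separable as soon
as `{x | f x ≠ 0}` lies in a separable set. -/
theorem separableSpace_tsupport_of_subset {X : Type*} [TopologicalSpace X]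
    [TopologicalSpace.MetrizableSpace X] {f : X → ℂ} {s : Set X}
    (hs : TopologicalSpace.IsSeparable s) (h : Function.support f ⊆ s) :
    TopologicalSpace.SeparableSpace (tsupport f) :=
  (separableSpace_coe_iff_isSeparable _).2 (hs.mono h).closure

/-- `C_s(X)`: the complex-valued bounded continuous functions on `X` whose support (the closure of
the cozero-set) is a separable subspace, as a star-subalgebra of `C_b(X)`. -/
def separableSupportAlgebra (X : Type*) [TopologicalSpace X]
    [TopologicalSpace.MetrizableSpace X] : NonUnitalStarSubalgebra ℂ (X →ᵇ ℂ) where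
  carrier := {f | TopologicalSpace.SeparableSpace (tsupport (f : X → ℂ))}
  zero_mem' := separableSpace_tsupport_of_subset (s := ∅) Set.countable_empty.isSeparable (by simp)
  add_mem' := by
    intro f g hf hg
    refine separableSpace_tsupport_of_subset
      (((separableSpace_coe_iff_isSeparable _).1 hf).union
        ((separableSpace_coe_iff_isSeparable _).1 hg)) ?_
    exact (Function.support_add (f : X → ℂ) g).trans
      (Set.union_subset_union (subset_tsupport _) (subset_tsupport _))
  mul_mem' := by
    intro f g hf _
    refine separableSpace_tsupport_of_subset ((separableSpace_coe_iff_isSeparable _).1 hf) ?_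
    intro x hx
    apply subset_tsupport
    intro h0
    exact hx (by simp [h0])
  smul_mem' := by
    intro c f hf
    refine separableSpace_tsupport_of_subset ((separableSpace_coe_iff_isSeparable _).1 hf) ?_
    intro x hx
    apply subset_tsupport
    intro h0
    exact hx (by simp [h0])
  star_mem' := by
    intro f hf
    refine separableSpace_tsupport_of_subset ((separableSpace_coe_iff_isSeparable _).1 hf) ?_
    intro x hx
    apply subset_tsupport
    intro h0
    exact hx (by simp [h0])

theorem mem_separableSupportAlgebra {X : Type*} [TopologicalSpace X]
    [TopologicalSpace.MetrizableSpace X] (f : X →ᵇ ℂ) :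
    f ∈ separableSupportAlgebra X ↔ TopologicalSpace.SeparableSpace (tsupport (f : X → ℂ)) :=
  Iff.rfl

/-- `C_s(X)` is closed in `C_b(X)`. With this instance Mathlib makes `C_s(X)`, with the supremum
norm, a commutative C*-algebra. -/
instance isClosed_separableSupportAlgebra (X : Type*) [TopologicalSpace X]
    [TopologicalSpace.MetrizableSpace X] :
    IsClosed (separableSupportAlgebra X : Set (X →ᵇ ℂ)) := by
  refine isClosed_of_closure_subset fun f hf => ?_
  obtain ⟨u, hu, hlim⟩ := mem_closure_iff_seq_limit.1 hf
  refine separableSpace_tsupport_of_subset (s := ⋃ n, tsupport (u n : X → ℂ))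
    (TopologicalSpace.IsSeparable.iUnion fun n =>
      (separableSpace_coe_iff_isSeparable _).1 (hu n)) ?_
  intro x hx
  have hev : Filter.Tendsto (fun n => u n x) Filter.atTop (nhds (f x)) :=
    ((BoundedContinuousFunction.lipschitz_eval_const x).continuous.tendsto f).comp hlim
  obtain ⟨n, hn⟩ := (hev.eventually_ne hx).exists
  exact Set.mem_iUnion.2 ⟨n, subset_tsupport _ hn⟩

/-- A subset of `X` is a cozero-set if it is `{x | f x ≠ 0}` for some bounded continuous `f`. -/
def IsCozeroSet {X : Type*} [TopologicalSpace X] (C : Set X) : Prop :=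
  ∃ f : X →ᵇ ℂ, C = Function.support (f : X → ℂ)

/-- `λX`: the union in the Stone–Čech compactification `βX` of all the sets `int cl C`, for `C` a
separable cozero-set of `X` (regarded as a subset of `βX`). -/
def lambdaSubspace (X : Type*) [TopologicalSpace X] : Set (StoneCech X) :=
  ⋃₀ {V | ∃ C : Set X, IsCozeroSet C ∧ TopologicalSpace.SeparableSpace C ∧
    V = interior (closure ((stoneCechUnit : X → StoneCech X) '' C))}

/-- Each point has a separable open neighbourhood. -/
def IsLocallySeparable (X : Type*) [TopologicalSpace X] : Prop :=
  ∀ x : X, ∃ U : Set X, IsOpen U ∧ x ∈ U ∧ TopologicalSpace.SeparableSpace U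

open Set Topology TopologicalSpace

/-! ### Closures and extensions in the Stone–Čech compactification. -/

section StoneCech

variable {X : Type*} [TopologicalSpace X]

/-! Extending functions to `βX` identifies `C_s(X)` with an algebra of functions vanishing off `λX`
and rich enough in bump functions to give `λX` its topology. As `C_s(X)` is an ideal of `C_b(X)`,
each character extends to `C(βX)`, hence is evaluation at a point, necessarily in `λX`
(`lambdaHomeomorph`). Local compactness holds because `λX` is open in `βX`. By local separability
`λX` contains the `βX`-closure of every separable subset of `X`; a sequence in `λX` lies in one such
compact closure, so it clusters in `λX`.

Non-normality (`not_normalSpace_of_isOpen`) comes from a copy of `ω₁ × ℕ` as a closed discrete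
subset of `X`. Take finite-to-one functions `e α : Iio α → ℕ`, coherent modulo finite sets. The
regions `A α` strictly below the graph of `e α` and `B α` on or above it increase with `α` modulo
finite sets, and their limit points in `βX` form two disjoint closed subsets of `λX`. Separating
these by open sets gives `G ⊆ ω₁ × ℕ` with all `A α \ G` and `B α ∩ G` finite. The least `n` with
`(ξ, n) ∉ G` then defines one function agreeing with every `e α` up to finitely many points. This is
impossible: it is constant on some infinite set below some `α`, where `e α` is finite-to-one. -/

theorem disjoint_closure_image_stoneCechUnit [NormalSpace X] {S T : Set X}
    (h : Disjoint (closure S) (closure T)) :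
    Disjoint (closure ((stoneCechUnit : X → StoneCech X) '' S))
      (closure ((stoneCechUnit : X → StoneCech X) '' T)) := by
  obtain ⟨f, h0, h1, hI⟩ := exists_continuous_zero_one_of_isClosed isClosed_closure
    isClosed_closure h
  have hg : Continuous (fun x => (⟨f x, hI x⟩ : Icc (0 : ℝ) 1)) := by fun_prop
  have hc := continuous_stoneCechExtend hg
  have hS : closure ((stoneCechUnit : X → StoneCech X) '' S) ⊆
      stoneCechExtend hg ⁻¹' {⟨0, by simp⟩} := by
    refine closure_minimal ?_ (isClosed_singleton.preimage hc)
    rintro _ ⟨x, hx, rfl⟩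
    simpa [stoneCechExtend_stoneCechUnit, Subtype.ext_iff] using h0 (subset_closure hx)
  have hT : closure ((stoneCechUnit : X → StoneCech X) '' T) ⊆
      stoneCechExtend hg ⁻¹' {⟨1, by simp⟩} := by
    refine closure_minimal ?_ (isClosed_singleton.preimage hc)
    rintro _ ⟨x, hx, rfl⟩
    simpa [stoneCechExtend_stoneCechUnit, Subtype.ext_iff] using h1 (subset_closure hx)
  refine Set.disjoint_left.2 fun p hp hq => ?_
  have := (hS hp).symm.trans (hT hq)
  simp at this

theorem compl_closure_image_compl_subset (U : Set X) :
    (closure ((stoneCechUnit : X → StoneCech X) '' Uᶜ))ᶜ ⊆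
      interior (closure ((stoneCechUnit : X → StoneCech X) '' U)) := by
  refine interior_maximal ?_ isClosed_closure.isOpen_compl
  intro p hp
  have : p ∈ closure ((stoneCechUnit : X → StoneCech X) '' (U ∪ Uᶜ)) := by
    rw [union_compl_self, image_univ]
    exact denseRange_stoneCechUnit p
  rw [image_union, closure_union] at this
  exact this.resolve_right hp

theorem closure_image_stoneCechUnit_subset_interior [NormalSpace X] {S U : Set X}
    (hU : IsOpen U) (h : closure S ⊆ U) :
    closure ((stoneCechUnit : X → StoneCech X) '' S) ⊆
      interior (closure ((stoneCechUnit : X → StoneCech X) '' U)) := by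
  refine Subset.trans ?_ (compl_closure_image_compl_subset U)
  refine (disjoint_closure_image_stoneCechUnit ?_).subset_compl_right
  rw [hU.isClosed_compl.closure_eq]
  exact Set.disjoint_compl_right_iff_subset.2 h

theorem stoneCechUnit_mem_closure_image [CompletelyRegularSpace X] {S : Set X} {x : X} :
    (stoneCechUnit x : StoneCech X) ∈ closure ((stoneCechUnit : X → StoneCech X) '' S) ↔
      x ∈ closure S := by
  rw [isInducing_stoneCechUnit.closure_eq_preimage_closure_image S, mem_preimage]

theorem BoundedContinuousFunction.exists_stoneCech_extension (f : X →ᵇ ℂ) :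
    ∃ F : C(StoneCech X, ℂ), ∀ x, F (stoneCechUnit x) = f x := by
  have hg : Continuous (fun x =>
      (⟨f x, by simpa using f.norm_coe_le_norm x⟩ : ↥(Metric.closedBall (0 : ℂ) ‖f‖))) := by fun_prop
  have : CompactSpace ↥(Metric.closedBall (0 : ℂ) ‖f‖) :=
    isCompact_iff_compactSpace.1 (isCompact_closedBall _ _)
  refine ⟨⟨fun p => (stoneCechExtend hg p).1,
    continuous_subtype_val.comp (continuous_stoneCechExtend hg)⟩, fun x => ?_⟩
  simp [stoneCechExtend_stoneCechUnit]

/-- The continuous extension to `βX` of a bounded continuous function on `X`. -/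
noncomputable def stoneCechLift (f : X →ᵇ ℂ) : C(StoneCech X, ℂ) :=
  f.exists_stoneCech_extension.choose

@[simp]
theorem stoneCechLift_stoneCechUnit (f : X →ᵇ ℂ) (x : X) :
    stoneCechLift f (stoneCechUnit x) = f x :=
  f.exists_stoneCech_extension.choose_spec x

theorem stoneCech_ext {F G : C(StoneCech X, ℂ)}
    (h : ∀ x : X, F (stoneCechUnit x) = G (stoneCechUnit x)) : F = G :=
  DFunLike.coe_injective <|
    denseRange_stoneCechUnit.equalizer F.continuous G.continuous (funext h)

/-- The restriction to `X` of a continuous function on `βX`. -/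
noncomputable def stoneCechRestrict (F : C(StoneCech X, ℂ)) : X →ᵇ ℂ :=
  (BoundedContinuousFunction.mkOfCompact F).compContinuous
    ⟨stoneCechUnit, continuous_stoneCechUnit⟩

@[simp]
theorem stoneCechRestrict_apply (F : C(StoneCech X, ℂ)) (x : X) :
    stoneCechRestrict F x = F (stoneCechUnit x) := rfl

@[simp]
theorem stoneCechLift_restrict (F : C(StoneCech X, ℂ)) :
    stoneCechLift (stoneCechRestrict F) = F := stoneCech_ext fun x => by simp

theorem IsCozeroSet.isOpen {U : Set X} (hU : IsCozeroSet U) : IsOpen U := by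
  obtain ⟨f, rfl⟩ := hU
  exact f.continuous.isOpen_support

theorem isOpen_lambdaSubspace : IsOpen (lambdaSubspace X) := by
  refine isOpen_sUnion ?_
  rintro _ ⟨C, _, _, rfl⟩
  exact isOpen_interior

theorem locallyCompactSpace_lambdaSubspace : LocallyCompactSpace (lambdaSubspace X) :=
  isOpen_lambdaSubspace.isOpenEmbedding_subtypeVal.locallyCompactSpace

end StoneCech

/-! ### The spectrum as `λX`, and countable compactness. -/

section Lambda

variable {X : Type*} [TopologicalSpace X] [MetrizableSpace X]

theorem IsOpen.isCozeroSet {U : Set X} (hU : IsOpen U) : IsCozeroSet U := by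
  let _ := metrizableSpaceMetric X
  -- `Metric.infDist` to the empty set is 0, so `U = X` needs its own function.
  rcases Uᶜ.eq_empty_or_nonempty with h | h
  · refine ⟨BoundedContinuousFunction.const X 1, ?_⟩
    rw [compl_empty_iff.1 h]
    ext x; simp
  · refine ⟨BoundedContinuousFunction.ofNormedAddCommGroup
      (fun x => ((min 1 (Metric.infDist x Uᶜ) : ℝ) : ℂ)) ?_ 1 ?_, ?_⟩
    · exact Complex.continuous_ofReal.comp
        (continuous_const.min (Metric.continuous_infDist_pt _))
    · intro x
      rw [Complex.norm_real, Real.norm_of_nonneg (le_min zero_le_one Metric.infDist_nonneg)]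
      exact min_le_left _ _
    · ext x
      have h1 := hU.isClosed_compl.mem_iff_infDist_zero h (x := x)
      have h2 : min 1 (Metric.infDist x Uᶜ) = 0 ↔ Metric.infDist x Uᶜ = 0 := by
        constructor
        · intro h3
          rcases min_choice 1 (Metric.infDist x Uᶜ) with h4 | h4 <;> rw [h4] at h3
          · norm_num at h3
          · exact h3
        · intro h3; simp [h3]
      rw [Function.mem_support]
      change x ∈ U ↔ ((min 1 (Metric.infDist x Uᶜ) : ℝ) : ℂ) ≠ 0
      rw [Ne, Complex.ofReal_eq_zero, h2, ← h1]
      simp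

theorem mem_lambdaSubspace {p : StoneCech X} :
    p ∈ lambdaSubspace X ↔ ∃ U : Set X, IsOpen U ∧ IsSeparable U ∧
      p ∈ interior (closure ((stoneCechUnit : X → StoneCech X) '' U)) := by
  constructor
  · rintro ⟨_, ⟨C, hC, hs, rfl⟩, hp⟩
    exact ⟨C, hC.isOpen, (separableSpace_coe_iff_isSeparable _).1 hs, hp⟩
  · rintro ⟨U, hU, hs, hp⟩
    exact ⟨_, ⟨U, hU.isCozeroSet, (separableSpace_coe_iff_isSeparable _).2 hs, rfl⟩, hp⟩

theorem mem_separableSupportAlgebra_of_subset {f : X →ᵇ ℂ} {s : Set X} (hs : IsSeparable s)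
    (h : Function.support (f : X → ℂ) ⊆ s) : f ∈ separableSupportAlgebra X :=
  separableSpace_tsupport_of_subset hs h

theorem isSeparable_support {f : X →ᵇ ℂ} (hf : f ∈ separableSupportAlgebra X) :
    IsSeparable (Function.support (f : X → ℂ)) :=
  ((separableSpace_coe_iff_isSeparable _).1 hf).mono (subset_tsupport _)

theorem mul_mem_separableSupportAlgebra (g : X →ᵇ ℂ) {f : X →ᵇ ℂ}
    (hf : f ∈ separableSupportAlgebra X) : g * f ∈ separableSupportAlgebra X :=
  mem_separableSupportAlgebra_of_subset (isSeparable_support hf) fun x hx h0 => hx (by simp [h0])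

/-- By density of `X`, the open set where the extension is non-zero lies in the closure of its trace
on `X`, the separable cozero-set of `f`. -/
theorem mem_lambdaSubspace_of_lift_ne_zero {f : X →ᵇ ℂ} (hf : f ∈ separableSupportAlgebra X)
    {p : StoneCech X} (hp : stoneCechLift f p ≠ 0) : p ∈ lambdaSubspace X := by
  refine mem_lambdaSubspace.2 ⟨Function.support f, f.continuous.isOpen_support,
    isSeparable_support hf, ?_⟩
  refine mem_interior.2 ⟨{q | stoneCechLift f q ≠ 0}, ?_,
    isOpen_ne_fun (stoneCechLift f).continuous continuous_const, hp⟩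
  intro q hq
  refine closure_mono ?_ (denseRange_stoneCechUnit.open_subset_closure_inter
    (isOpen_ne_fun (stoneCechLift f).continuous continuous_const) hq)
  rintro _ ⟨hx, x, rfl⟩
  exact ⟨x, by simpa using hx, rfl⟩

/-- A Urysohn function living inside `int cl U`, with `U` separable, restricts to a function on `X`
that vanishes off the closure of `U` in `X`. -/
theorem exists_lift_eq_one_of_mem_lambdaSubspace {p : StoneCech X} (hp : p ∈ lambdaSubspace X)
    {V : Set (StoneCech X)} (hV : IsOpen V) (hpV : p ∈ V) :
    ∃ f ∈ separableSupportAlgebra X, stoneCechLift f p = 1 ∧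
      ∀ q, stoneCechLift f q ≠ 0 → q ∈ V := by
  obtain ⟨U, -, hs, hpU⟩ := mem_lambdaSubspace.1 hp
  set N := V ∩ interior (closure ((stoneCechUnit : X → StoneCech X) '' U)) with hN
  have hNo : IsOpen N := hV.inter isOpen_interior
  obtain ⟨f, h0, h1, -⟩ := exists_continuous_zero_one_of_isClosed hNo.isClosed_compl
    (isClosed_singleton (x := p)) (by simpa [hN] using ⟨hpV, hpU⟩)
  let F : C(StoneCech X, ℂ) := ⟨fun q => (f q : ℂ), by fun_prop⟩
  have hF : ∀ q, F q ≠ 0 → q ∈ N := by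
    intro q hq
    by_contra hqN
    exact hq (by simpa [F] using h0 hqN)
  refine ⟨stoneCechRestrict F, mem_separableSupportAlgebra_of_subset hs.closure ?_, ?_, ?_⟩
  · intro x hx
    exact stoneCechUnit_mem_closure_image.1 (interior_subset (hF _ hx).2)
  · simpa [F] using h1 rfl
  · intro q hq
    rw [stoneCechLift_restrict] at hq
    exact (hF q hq).1

/-- Evaluation at a point of `λX`, as a character of `C_s(X)`. -/
noncomputable def lambdaEval (p : lambdaSubspace X) :
    WeakDual.characterSpace ℂ (separableSupportAlgebra X) :=
  ⟨LinearMap.mkContinuous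
    { toFun := fun f => stoneCechLift (f : X →ᵇ ℂ) p
      map_add' := fun f g => by
        have : stoneCechLift ((f : X →ᵇ ℂ) + (g : X →ᵇ ℂ)) =
            stoneCechLift (f : X →ᵇ ℂ) + stoneCechLift (g : X →ᵇ ℂ) :=
          stoneCech_ext fun x => by simp
        exact congr($this p)
      map_smul' := fun c f => by
        have : stoneCechLift (c • (f : X →ᵇ ℂ)) = c • stoneCechLift (f : X →ᵇ ℂ) :=
          stoneCech_ext fun x => by simp
        exact congr($this p) } 1 (fun f => by
      have hcl : IsClosed {q | ‖stoneCechLift (f : X →ᵇ ℂ) q‖ ≤ ‖f‖} :=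
        isClosed_le (by fun_prop) continuous_const
      have : closure (range (stoneCechUnit : X → StoneCech X)) ⊆ _ :=
        closure_minimal (by
          rintro _ ⟨x, rfl⟩
          simpa using (f : X →ᵇ ℂ).norm_coe_le_norm x) hcl
      simpa using this (denseRange_stoneCechUnit (p : StoneCech X))), by
    constructor
    · obtain ⟨f, hf, h1, -⟩ := exists_lift_eq_one_of_mem_lambdaSubspace p.2 isOpen_univ trivial
      intro h
      have : stoneCechLift f p = 0 := congr($h (⟨f, hf⟩ : separableSupportAlgebra X))
      simp [h1] at this
    · intro f g
      have : stoneCechLift ((f : X →ᵇ ℂ) * (g : X →ᵇ ℂ)) =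
          stoneCechLift (f : X →ᵇ ℂ) * stoneCechLift (g : X →ᵇ ℂ) :=
        stoneCech_ext fun x => by simp
      exact congr($this p)⟩

@[simp]
theorem lambdaEval_apply (p : lambdaSubspace X) (f : separableSupportAlgebra X) :
    lambdaEval p f = stoneCechLift (f : X →ᵇ ℂ) p := rfl

theorem isInducing_lambdaEval : IsInducing (lambdaEval (X := X)) := by
  have hcont : Continuous (lambdaEval (X := X)) := by
    refine Continuous.subtype_mk (WeakDual.continuous_of_continuous_eval fun f => ?_) _
    change Continuous fun p : lambdaSubspace X => stoneCechLift (f : X →ᵇ ℂ) p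
    fun_prop
  refine isInducing_iff_nhds.2 fun p => le_antisymm hcont.continuousAt.le_comap ?_
  intro s hs
  obtain ⟨t, ht, hts⟩ := mem_nhds_subtype _ _ _ |>.1 hs
  obtain ⟨V, hVt, hV, hpV⟩ := mem_nhds_iff.1 ht
  obtain ⟨f, hf, h1, h2⟩ := exists_lift_eq_one_of_mem_lambdaSubspace p.2 hV hpV
  have hev : Continuous fun φ : WeakDual.characterSpace ℂ (separableSupportAlgebra X) =>
      φ (⟨f, hf⟩ : separableSupportAlgebra X) :=
    (WeakDual.eval_continuous _).comp continuous_subtype_val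
  refine ⟨{φ | φ (⟨f, hf⟩ : separableSupportAlgebra X) ≠ 0},
    (isOpen_ne_fun hev continuous_const).mem_nhds (by simp [h1]), ?_⟩
  intro q hq
  exact hts (hVt (h2 q hq))

theorem lambdaEval_injective : Function.Injective (lambdaEval (X := X)) :=
  isInducing_lambdaEval.injective

/-- With `φ u ≠ 0`, the formula `ψ g = φ (g * u) / φ u` extends `φ` to a character of `C(βX)`, so it
is evaluation at some `p`; then `φ u ≠ 0` forces `p` into `λX`. -/
theorem lambdaEval_surjective : Function.Surjective (lambdaEval (X := X)) := by
  intro φ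
  obtain ⟨u, hu⟩ : ∃ u, φ u ≠ 0 := by
    by_contra! h
    exact φ.2.1 (ContinuousLinearMap.ext h)
  let T : C(StoneCech X, ℂ) → separableSupportAlgebra X := fun g =>
    ⟨stoneCechRestrict g * u, mul_mem_separableSupportAlgebra _ u.2⟩
  have hT : ∀ g h, φ (T (g * h)) * φ u = φ (T g) * φ (T h) := by
    intro g h
    rw [← map_mul, ← map_mul]
    congr 1
    ext x
    simp [T]; ring
  let ψ : C(StoneCech X, ℂ) →ₐ[ℂ] ℂ := AlgHom.ofLinearMap
    { toFun := fun g => φ (T g) / φ u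
      map_add' := fun g h => by
        rw [← add_div, ← map_add]
        congr 2
        ext x
        simp [T]; ring
      map_smul' := fun c g => by
        have : T (c • g) = c • T g := by
          ext x
          simp [T]; ring
        rw [this, map_smul]
        simp [mul_div_assoc] }
    (by
      have : T 1 = u := by
        ext x; simp [T]
      simp [this, hu])
    (fun g h => by
      simp only [LinearMap.coe_mk, AddHom.coe_mk]
      rw [div_mul_div_comm, ← hT, mul_div_mul_right _ _ hu])
  obtain ⟨p, hp⟩ := (WeakDual.CharacterSpace.homeoEval (StoneCech X) ℂ).surjective
    (WeakDual.CharacterSpace.equivAlgHom.symm ψ)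
  have hψ : ∀ g, ψ g = g p := fun g => congr($hp g).symm
  have hφ : ∀ f : separableSupportAlgebra X, φ f = stoneCechLift (f : X →ᵇ ℂ) p := by
    intro f
    rw [← hψ]
    change φ f = φ (T _) / φ u
    rw [eq_div_iff hu, ← map_mul]
    congr 1
    ext x
    simp [T]
  refine ⟨⟨p, mem_lambdaSubspace_of_lift_ne_zero u.2 (by rwa [← hφ])⟩, ?_⟩
  ext f
  exact (hφ f).symm

/-- The spectrum of `C_s(X)` is `λX`. -/
noncomputable def lambdaHomeomorph :
    lambdaSubspace X ≃ₜ WeakDual.characterSpace ℂ (separableSupportAlgebra X) :=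
  (Equiv.ofBijective _ ⟨lambdaEval_injective, lambdaEval_surjective⟩).toHomeomorphOfIsInducing
    isInducing_lambdaEval

/-- The closure of `S` is separable metrizable, hence Lindelöf, so countably many separable open
sets cover it. -/
theorem IsLocallySeparable.exists_isOpen_isSeparable_superset (hloc : IsLocallySeparable X)
    {S : Set X} (hS : IsSeparable S) : ∃ U, IsOpen U ∧ IsSeparable U ∧ closure S ⊆ U := by
  have : SeparableSpace (closure S) := (separableSpace_coe_iff_isSeparable _).2 hS.closure
  let _ := metrizableSpaceMetric X
  have : SecondCountableTopology (closure S) := UniformSpace.secondCountable_of_separable _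
  have hL : IsLindelof (closure S) := isLindelof_iff_lindelofSpace.2 inferInstance
  choose U hUo hU hUs using hloc
  obtain ⟨t, ht, hst⟩ := hL.elim_countable_subcover U hUo fun x _ => mem_iUnion.2 ⟨x, hU x⟩
  have := ht.to_subtype
  refine ⟨⋃ i ∈ t, U i, isOpen_biUnion fun i _ => hUo i, ?_, hst⟩
  rw [biUnion_eq_iUnion]
  exact IsSeparable.iUnion fun i => (separableSpace_coe_iff_isSeparable _).1 (hUs i)

theorem IsLocallySeparable.closure_image_subset_lambdaSubspace (hloc : IsLocallySeparable X)
    {S : Set X} (hS : IsSeparable S) :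
    closure ((stoneCechUnit : X → StoneCech X) '' S) ⊆ lambdaSubspace X := by
  let _ := metrizableSpaceMetric X
  obtain ⟨U, hU, hs, h⟩ := hloc.exists_isOpen_isSeparable_superset hS
  exact fun p hp => mem_lambdaSubspace.2
    ⟨U, hU, hs, closure_image_stoneCechUnit_subset_interior hU h hp⟩

theorem IsLocallySeparable.countablyCompactSpace_lambdaSubspace (hloc : IsLocallySeparable X) :
    CountablyCompactSpace (lambdaSubspace X) := by
  refine ⟨isCountablyCompact_iff_seq_clusterPt.2 fun x _ => ?_⟩
  choose U _ hUs hxU using fun n => mem_lambdaSubspace.1 (x n).2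
  set K := closure ((stoneCechUnit : X → StoneCech X) '' ⋃ n, U n)
  have hK : K ⊆ lambdaSubspace X :=
    hloc.closure_image_subset_lambdaSubspace (IsSeparable.iUnion hUs)
  have hxK : ∀ n, (x n : StoneCech X) ∈ K := fun n =>
    closure_mono (image_mono (subset_iUnion U n)) (interior_subset (hxU n))
  obtain ⟨a, ha, hac⟩ := (isClosed_closure (s := (stoneCechUnit : X → StoneCech X) ''
    ⋃ n, U n)).isCompact.exists_mapClusterPt (f := Filter.atTop)
    (u := fun n => (x n : StoneCech X)) (Filter.tendsto_principal.2 (.of_forall hxK))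
  refine ⟨⟨a, hK ha⟩, trivial, ?_⟩
  rw [mapClusterPt_iff_frequently] at hac ⊢
  intro s hs
  obtain ⟨t, ht, hts⟩ := mem_nhds_subtype _ _ _ |>.1 hs
  exact (hac t ht).mono fun n hn => hts hn

end Lambda

/-! ### Coherent finite-to-one functions on `ω₁`. -/

section Coherent

variable {W : Type*} [LinearOrder W]

theorem exists_forall_lt_of_countable [Uncountable W] (hW : ∀ α : W, (Iio α).Countable)
    {S : Set W} (hS : S.Countable) : ∃ α, ∀ ξ ∈ S, ξ < α := by
  by_contra! h
  refine not_countable_univ (α := W) ((hS.biUnion (t := fun ξ _ => Iic ξ) fun ξ _ => ?_).mono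
    fun α _ => ?_)
  · rw [← Iio_insert]
    exact (hW ξ).insert ξ
  · obtain ⟨ξ, h1, h2⟩ := h α
    exact mem_biUnion h1 h2

/-- A coherent family of finite-to-one functions on an uncountable well-order is non-trivial. -/
theorem exists_infinite_ne_of_finite_to_one [Uncountable W] (hW : ∀ α : W, (Iio α).Countable)
    {e : W → W → ℕ} (he : ∀ α k, {ξ | ξ < α ∧ e α ξ ≤ k}.Finite) (f : W → ℕ) :
    ∃ α, {ξ | ξ < α ∧ f ξ ≠ e α ξ}.Infinite := by
  obtain ⟨k, hk⟩ : ∃ k, (f ⁻¹' {k}).Infinite := by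
    by_contra! h
    refine not_countable_univ (α := W) ((countable_iUnion fun k => (h k).countable).mono
      fun ξ _ => mem_iUnion.2 ⟨f ξ, rfl⟩)
  obtain ⟨α, hα⟩ := exists_forall_lt_of_countable hW
    (countable_range fun n => (hk.natEmbedding _ n : W))
  refine ⟨α, fun hfin => ?_⟩
  refine (infinite_range_of_injective (Subtype.val_injective.comp (hk.natEmbedding _).injective))
    (((he α k).union hfin).subset ?_)
  rintro _ ⟨n, rfl⟩
  have h1 := hα _ ⟨n, rfl⟩
  have h2 : f (hk.natEmbedding _ n : W) = k := (hk.natEmbedding _ n).2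
  simp only [Function.comp_apply]
  by_cases h3 : e α (hk.natEmbedding _ n : W) = k
  · exact Or.inl ⟨h1, h3.le⟩
  · exact Or.inr ⟨h1, by rw [h2]; exact Ne.symm h3⟩

/-- On a well-order with countable initial segments there is a family of finite-to-one functions
`e α : Iio α → ℕ` which is coherent modulo finite sets. -/
theorem exists_coherent_finite_to_one [WellFoundedLT W] (hW : ∀ α : W, (Iio α).Countable) :
    ∃ e : W → W → ℕ, (∀ α k, {ξ | ξ < α ∧ e α ξ ≤ k}.Finite) ∧
      ∀ α β, β < α → {ξ | ξ < β ∧ e α ξ ≠ e β ξ}.Finite := by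
  have hinj : ∀ α : W, ∃ c : W → ℕ, InjOn c (Iio α) := fun α =>
    countable_iff_exists_injOn.1 (hW α)
  choose c hc using hinj
  have hmin : ∀ α ξ : W, ∃ β, ξ < α → ξ ≤ β ∧ β < α ∧
      ∀ γ, ξ ≤ γ → γ < α → c α β ≤ c α γ := by
    intro α ξ
    by_cases h : ξ < α
    · obtain ⟨β, hβ, hm⟩ := exists_minimalFor_of_wellFoundedLT (fun γ => ξ ≤ γ ∧ γ < α) (c α)
        ⟨ξ, le_rfl, h⟩
      exact ⟨β, fun _ => ⟨hβ.1, hβ.2, fun γ h1 h2 =>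
        (le_total (c α β) (c α γ)).elim id (hm ⟨h1, h2⟩)⟩⟩
    · exact ⟨ξ, fun h' => (h h').elim⟩
  choose b hb using hmin
  -- Walk from `α` down to `ξ`, stepping each time to the point of `[ξ, α)` with the least `c α`; `e
  -- α ξ` is the largest weight `c` met. The end value `e ξ ξ` is arbitrary, whence each `insert`
  -- below.
  let F : ∀ α : W, (∀ β, β < α → W → ℕ) → W → ℕ := fun α r ξ =>
    if h : b α ξ < α then max (r (b α ξ) h ξ) (c α (b α ξ)) else 0
  let e : W → W → ℕ := wellFounded_lt.fix F
  have he : ∀ α ξ, ξ < α → e α ξ = max (e (b α ξ) ξ) (c α (b α ξ)) := by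
    intro α ξ h
    have : e α = F α (fun β _ => e β) := wellFounded_lt.fix_eq F α
    rw [this]
    simp only [F]
    rw [dif_pos (hb α ξ h).2.1]
  have hfin : ∀ α k, {β | β < α ∧ c α β ≤ k}.Finite := by
    intro α k
    refine Set.Finite.of_finite_image ((finite_Iic k).subset ?_)
      ((hc α).mono fun β hβ => hβ.1)
    rintro _ ⟨β, hβ, rfl⟩
    exact hβ.2
  have h1 : ∀ α k, {ξ | ξ < α ∧ e α ξ ≤ k}.Finite := by
    intro α
    induction α using WellFoundedLT.induction with
    | ind α ih =>
      intro k
      refine ((hfin α k).biUnion (t := fun β => insert β {ξ | ξ < β ∧ e β ξ ≤ k})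
        fun β hβ => (ih β hβ.1 k).insert β).subset ?_
      rintro ξ ⟨hξ, hk⟩
      rw [he α ξ hξ, max_le_iff] at hk
      obtain ⟨h2, h3, -⟩ := hb α ξ hξ
      exact mem_biUnion (x := b α ξ) ⟨h3, hk.2⟩ (h2.eq_or_lt.imp id fun h => ⟨h, hk.1⟩)
  refine ⟨e, h1, fun α => ?_⟩
  induction α using WellFoundedLT.induction with
  | ind α ih =>
    intro β hβ
    have hsym : ∀ γ < α, {ξ | ξ < γ ∧ ξ < β ∧ e γ ξ ≠ e β ξ}.Finite := by
      intro γ hγ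
      rcases lt_trichotomy γ β with h | rfl | h
      · exact (ih β hβ γ h).subset fun ξ hξ => ⟨hξ.1, hξ.2.2.symm⟩
      · simp
      · exact (ih γ hγ β h).subset fun ξ hξ => ⟨hξ.2.1, hξ.2.2⟩
    -- Since `β` is itself a candidate, the first step `γ` from `α` has weight at most `c α β`,
    -- which leaves finitely many `γ`. For each, either `e γ ξ ≤ c α β`, for finitely many `ξ`, or
    -- `e α ξ = e γ ξ` and induction compares `γ` with `β`.
    refine ((hfin α (c α β)).biUnion (t := fun γ => insert γ
      ({ξ | ξ < γ ∧ e γ ξ ≤ c α β} ∪ {ξ | ξ < γ ∧ ξ < β ∧ e γ ξ ≠ e β ξ}))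
      fun γ hγ => ((h1 γ _).union (hsym γ hγ.1)).insert γ).subset ?_
    rintro ξ ⟨hξ, hne⟩
    obtain ⟨h2, h3, h4⟩ := hb α ξ (hξ.trans hβ)
    have h5 := h4 β hξ.le hβ
    refine mem_biUnion (x := b α ξ) ⟨h3, h5⟩ (h2.eq_or_lt.imp id fun h => ?_)
    rcases le_or_gt (e (b α ξ) ξ) (c α β) with h6 | h6
    · exact Or.inl ⟨h, h6⟩
    · refine Or.inr ⟨h, hξ, ?_⟩
      rwa [he α ξ (hξ.trans hβ), max_eq_left (h5.trans h6.le)] at hne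

end Coherent

/-! ### Limit points of infinite subsets of an indexed family. -/

section LimitSet

variable {ι Z : Type*} [TopologicalSpace Z] {y : ι → Z} {S T : Set ι}

/-- The points of `Z` that lie in the closure of `y '' (S \ F)` for all finite sets `F`. -/
def limitSet (y : ι → Z) (S : Set ι) : Set Z :=
  {p | ∀ F : Set ι, F.Finite → p ∈ closure (y '' (S \ F))}

theorem isClosed_limitSet : IsClosed (limitSet y S) := by
  simp only [limitSet, ofPred_forall]
  exact isClosed_iInter fun F => isClosed_iInter fun _ => isClosed_closure

theorem limitSet_mono_of_finite_diff (h : (S \ T).Finite) : limitSet y S ⊆ limitSet y T := by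
  intro p hp F hF
  refine closure_mono (image_mono ?_) (hp _ (h.union hF))
  rintro d ⟨hd, hd'⟩
  exact ⟨by_contra fun hT => hd' (Or.inl ⟨hd, hT⟩), fun hdF => hd' (Or.inr hdF)⟩

theorem limitSet_subset_closure : limitSet y S ⊆ closure (y '' S) := fun p hp => by
  simpa using hp ∅ finite_empty

theorem limitSet_subset_union (T : Set ι) :
    limitSet y S ⊆ limitSet y (S ∩ T) ∪ closure (y '' (S \ T)) := by
  intro p hp
  refine or_iff_not_imp_right.2 fun h F hF => ?_
  have h1 : y '' (S \ F) ⊆ y '' ((S ∩ T) \ F) ∪ y '' (S \ T) := by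
    rw [← image_union]
    refine image_mono fun d hd => ?_
    by_cases hT : d ∈ T
    · exact Or.inl ⟨⟨hd.1, hT⟩, hd.2⟩
    · exact Or.inr ⟨hd.1, hT⟩
  have h2 := closure_mono h1 (hp F hF)
  rw [closure_union] at h2
  exact h2.resolve_right h

theorem limitSet_nonempty [CompactSpace Z] (hS : S.Infinite) : (limitSet y S).Nonempty := by
  have : (Filter.cofinite ⊓ Filter.principal S).NeBot :=
    Filter.cofinite_inf_principal_neBot_iff.2 hS
  obtain ⟨p, hp⟩ := exists_clusterPt_of_compactSpace
    (Filter.map y (Filter.cofinite ⊓ Filter.principal S))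
  refine ⟨p, fun F hF => hp.mem_closure_of_mem _ (Filter.image_mem_map ?_)⟩
  rw [sdiff_eq, inter_comm]
  exact Filter.inter_mem_inf hF.compl_mem_cofinite (Filter.mem_principal_self S)

end LimitSet

/-! ### The combinatorial criterion for non-normality. -/

section NotNormal

theorem finite_setOf_fst_mem_snd_lt {W : Type*} {E : Set W} (hE : E.Finite) (g : W → ℕ) :
    {d : W × ℕ | d.1 ∈ E ∧ d.2 < g d.1}.Finite := by
  refine (hE.biUnion (t := fun ξ => (Prod.mk ξ) '' Iio (g ξ))
    fun ξ _ => (finite_Iio _).image _).subset ?_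
  rintro ⟨ξ, n⟩ ⟨h1, h2⟩
  exact mem_biUnion h1 ⟨n, h2, rfl⟩

variable {W Z : Type*} [LinearOrder W] [TopologicalSpace Z]

/-- The neighbourhood `N` sees only indices below some `α`, so within `N` every limit set is
contained in the single closed set `limitSet y (S α)`. -/
theorem mem_iUnion_limitSet_of_mem_closure [Uncountable W] (hW : ∀ α : W, (Iio α).Countable)
    {y : W × ℕ → Z} {S : W → Set (W × ℕ)} (hS : ∀ α β, α ≤ β → (S α \ S β).Finite)
    (hS' : ∀ α β, α ≤ β → ((S β ∩ {d | d.1 < α}) \ S α).Finite)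
    {p : Z} (hp : p ∈ closure (⋃ α, limitSet y (S α)))
    (hN : ∃ N, IsOpen N ∧ p ∈ N ∧ (y ⁻¹' N).Countable) : p ∈ ⋃ α, limitSet y (S α) := by
  obtain ⟨N, hNo, hpN, hNc⟩ := hN
  obtain ⟨α, hα⟩ := exists_forall_lt_of_countable hW (hNc.image Prod.fst)
  refine mem_iUnion.2 ⟨α, ?_⟩
  have key : N ∩ (⋃ β, limitSet y (S β)) ⊆ limitSet y (S α) := by
    rintro q ⟨hqN, hq⟩
    obtain ⟨β, hβ⟩ := mem_iUnion.1 hq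
    have h1 := limitSet_mono_of_finite_diff (hS β _ (le_max_right α β)) hβ
    rcases limitSet_subset_union {d | d.1 < α} h1 with h2 | h2
    · exact limitSet_mono_of_finite_diff (hS' α _ (le_max_left α β)) h2
    · obtain ⟨_, h3, d, hd, rfl⟩ := mem_closure_iff.1 h2 N hNo hqN
      exact (hd.2 (hα _ ⟨d, h3, rfl⟩)).elim
  exact closure_minimal key isClosed_limitSet (hNo.inter_closure ⟨hpN, hp⟩)

/-- An open subspace `Λ` of a compact space is not normal if it contains a copy of a discrete
set of size `ℵ₁`, disjoint subsets of which have disjoint closures, such that `Λ` contains the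
closure of each countable subset and each point of `Λ` has a neighbourhood with only countably
many points of the discrete set. -/
theorem not_normalSpace_of_isOpen [WellFoundedLT W] [Uncountable W]
    (hW : ∀ α : W, (Iio α).Countable) [CompactSpace Z] {Λ : Set Z} (hΛ : IsOpen Λ)
    (y : W × ℕ → Z) (hy : ∀ S T, Disjoint S T → Disjoint (closure (y '' S)) (closure (y '' T)))
    (hc : ∀ S : Set (W × ℕ), S.Countable → closure (y '' S) ⊆ Λ)
    (hN : ∀ p ∈ Λ, ∃ N, IsOpen N ∧ p ∈ N ∧ (y ⁻¹' N).Countable) : ¬ NormalSpace Λ := by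
  intro hnormal
  obtain ⟨e, he, hcoh⟩ := exists_coherent_finite_to_one hW
  set A : W → Set (W × ℕ) := fun α => {d | d.1 < α ∧ d.2 < e α d.1} with hA
  set B : W → Set (W × ℕ) := fun α => {d | d.1 < α ∧ e α d.1 ≤ d.2} with hB
  -- Below `α` the regions for `α` and `β` differ only in the finitely many columns where `e α` and
  -- `e β` disagree, and there only under the larger value.
  have hfin : ∀ α β, α ≤ β → {d : W × ℕ | (d.1 < α ∧ e β d.1 ≠ e α d.1) ∧
      d.2 < max (e α d.1) (e β d.1)}.Finite := by
    intro α β h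
    refine finite_setOf_fst_mem_snd_lt (E := {ξ | ξ < α ∧ e β ξ ≠ e α ξ}) ?_ fun ξ => max (e α ξ) (e β ξ)
    rcases h.eq_or_lt with rfl | h
    · simp
    · exact hcoh β α h
  have hA1 : ∀ α β, α ≤ β → (A α \ A β).Finite := fun α β h => (hfin α β h).subset <| by
    rintro d ⟨⟨h1, h2⟩, h3⟩
    have h4 : e β d.1 ≤ d.2 := not_lt.1 fun h4 => h3 ⟨h1.trans_le h, h4⟩
    exact ⟨⟨h1, (h4.trans_lt h2).ne⟩, lt_max_of_lt_left h2⟩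
  have hA2 : ∀ α β, α ≤ β → ((A β ∩ {d | d.1 < α}) \ A α).Finite :=
    fun α β h => (hfin α β h).subset <| by
      rintro d ⟨⟨⟨_, h2⟩, h1⟩, h3⟩
      have h4 : e α d.1 ≤ d.2 := not_lt.1 fun h4 => h3 ⟨h1, h4⟩
      exact ⟨⟨h1, (h4.trans_lt h2).ne'⟩, lt_max_of_lt_right h2⟩
  have hB1 : ∀ α β, α ≤ β → (B α \ B β).Finite := fun α β h => (hfin α β h).subset <| by
    rintro d ⟨⟨h1, h2⟩, h3⟩
    have h4 : d.2 < e β d.1 := not_le.1 fun h4 => h3 ⟨h1.trans_le h, h4⟩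
    exact ⟨⟨h1, (h2.trans_lt h4).ne'⟩, lt_max_of_lt_right h4⟩
  have hB2 : ∀ α β, α ≤ β → ((B β ∩ {d | d.1 < α}) \ B α).Finite :=
    fun α β h => (hfin α β h).subset <| by
      rintro d ⟨⟨⟨_, h2⟩, h1⟩, h3⟩
      have h4 : d.2 < e α d.1 := not_le.1 fun h4 => h3 ⟨h1, h4⟩
      exact ⟨⟨h1, (h2.trans_lt h4).ne⟩, lt_max_of_lt_left h4⟩
  have hcount : ∀ α : W, {d : W × ℕ | d.1 < α}.Countable := fun α =>
    ((hW α).prod (countable_univ (α := ℕ))).mono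
      fun d hd => mk_mem_prod (show d.1 ∈ Iio α from hd) (mem_univ d.2)
  have hAΛ : ∀ α, limitSet y (A α) ⊆ Λ := fun α => limitSet_subset_closure.trans
    (hc _ ((hcount α).mono fun d hd => hd.1))
  have hBΛ : ∀ α, limitSet y (B α) ⊆ Λ := fun α => limitSet_subset_closure.trans
    (hc _ ((hcount α).mono fun d hd => hd.1))
  have hclosed : ∀ S : W → Set (W × ℕ), (∀ α β, α ≤ β → (S α \ S β).Finite) →
      (∀ α β, α ≤ β → ((S β ∩ {d | d.1 < α}) \ S α).Finite) →
      IsClosed ((Subtype.val : Λ → Z) ⁻¹' ⋃ α, limitSet y (S α)) := by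
    intro S h1 h2
    refine isClosed_of_closure_subset fun p hp => ?_
    exact mem_iUnion_limitSet_of_mem_closure hW h1 h2
      (continuous_subtype_val.closure_preimage_subset _ hp) (hN p p.2)
  have hdisj : Disjoint ((Subtype.val : Λ → Z) ⁻¹' ⋃ α, limitSet y (A α))
      ((Subtype.val : Λ → Z) ⁻¹' ⋃ α, limitSet y (B α)) := by
    refine Set.disjoint_left.2 fun p hpA hpB => ?_
    obtain ⟨α, hα⟩ := mem_iUnion.1 hpA
    obtain ⟨β, hβ⟩ := mem_iUnion.1 hpB
    have h1 := limitSet_mono_of_finite_diff (hA1 α _ (le_max_left α β)) hα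
    have h2 := limitSet_mono_of_finite_diff (hB1 β _ (le_max_right α β)) hβ
    refine Set.disjoint_left.1 (hy _ _ ?_) (limitSet_subset_closure h1)
      (limitSet_subset_closure h2)
    exact Set.disjoint_left.2 fun d hd hd' => hd.2.not_ge hd'.2
  obtain ⟨U, V, hU, hV, hAU, hBV, hUV⟩ :=
    normal_separation (hclosed A hA1 hA2) (hclosed B hB1 hB2) hdisj
  have hU' := hΛ.isOpenMap_subtype_val U hU
  have hV' := hΛ.isOpenMap_subtype_val V hV
  set G : Set (W × ℕ) := y ⁻¹' (Subtype.val '' U) with hG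
  -- Were this set infinite, compactness would give it a limit point; that point lies in `U`, yet no
  -- point indexed by the set does.
  have hAG : ∀ α, (A α \ G).Finite := by
    intro α
    by_contra hinf
    obtain ⟨p, hp⟩ := limitSet_nonempty (y := y) hinf
    have hpA : p ∈ limitSet y (A α) :=
      limitSet_mono_of_finite_diff (by rw [sdiff_eq_empty.2 sdiff_subset]; exact finite_empty) hp
    have hpU : p ∈ Subtype.val '' U :=
      ⟨⟨p, hAΛ α hpA⟩, hAU (mem_iUnion.2 ⟨α, hpA⟩), rfl⟩
    obtain ⟨_, h1, d, hd, rfl⟩ := mem_closure_iff.1 (limitSet_subset_closure hp) _ hU' hpU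
    exact hd.2 h1
  have hBG : ∀ α, (B α ∩ G).Finite := by
    intro α
    by_contra hinf
    obtain ⟨p, hp⟩ := limitSet_nonempty (y := y) hinf
    have hpB : p ∈ limitSet y (B α) :=
      limitSet_mono_of_finite_diff (by rw [sdiff_eq_empty.2 inter_subset_left]; exact finite_empty)
        hp
    have hpV : p ∈ Subtype.val '' V :=
      ⟨⟨p, hBΛ α hpB⟩, hBV (mem_iUnion.2 ⟨α, hpB⟩), rfl⟩
    obtain ⟨_, ⟨v, hv, hvd⟩, d, hd, rfl⟩ :=
      mem_closure_iff.1 (limitSet_subset_closure hp) _ hV' hpV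
    obtain ⟨u, hu, hud⟩ := hd.2
    exact Set.disjoint_left.1 hUV hu (by rwa [Subtype.ext (hud.trans hvd.symm)])
  -- If a whole column lies in `G`, then `sInf ∅ = 0` is a harmless default: such a column is caught
  -- by `(ξ, e α ξ) ∈ B α ∩ G`.
  obtain ⟨α, hα⟩ := exists_infinite_ne_of_finite_to_one hW he
    fun ξ => sInf {n | (ξ, n) ∉ G}
  refine hα ((((hAG α).union (hBG α)).image Prod.fst).subset ?_)
  rintro ξ ⟨hξ, hne⟩
  by_cases h : (ξ, e α ξ) ∈ G
  · exact ⟨_, Or.inr ⟨⟨hξ, le_rfl⟩, h⟩, rfl⟩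
  · have hmem : e α ξ ∈ {n | (ξ, n) ∉ G} := h
    exact ⟨(ξ, sInf {n | (ξ, n) ∉ G}),
      Or.inl ⟨⟨hξ, (Nat.sInf_le hmem).lt_of_ne hne⟩, Nat.sInf_mem ⟨_, hmem⟩⟩, rfl⟩

end NotNormal

/-! ### Uncountable closed discrete sets, and non-normality of `λX`. -/

section Metrizable

variable {X : Type*} [TopologicalSpace X] [MetrizableSpace X]

/-- If for each `ε` a maximal `ε`-separated set were countable, `X` would be second countable; all
subsets of an `ε`-separated set are closed. -/
theorem exists_uncountable_forall_subset_isClosed (hsep : ¬ SeparableSpace X) :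
    ∃ D : Set X, ¬ D.Countable ∧ ∀ S ⊆ D, IsClosed S := by
  let _ := metrizableSpaceMetric X
  by_contra! hD
  refine hsep ?_
  have : SecondCountableTopology X := by
    refine Metric.secondCountable_of_almost_dense_set fun ε hε => ?_
    obtain ⟨D, hDmax⟩ := zorn_subset {N : Set X | N.Pairwise fun x y => ε ≤ dist x y} (by
      intro c hc hchain
      exact ⟨⋃₀ c, (pairwise_sUnion hchain.directedOn).2 fun s hs => hc hs,
        fun s hs => subset_sUnion_of_mem hs⟩)
    refine ⟨D, ?_, fun x => ?_⟩
    · by_contra hDc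
      obtain ⟨S, hSD, hS⟩ := hD D hDc
      exact hS (Metric.isClosed_of_pairwise_le_dist hε (hDmax.prop.mono hSD))
    · by_contra! h
      have hx : insert x D ∈ {N : Set X | N.Pairwise fun x y => ε ≤ dist x y} := by
        refine hDmax.prop.insert fun y hy _ => ⟨(h y hy).le, ?_⟩
        rw [dist_comm]
        exact (h y hy).le
      have := h x (hDmax.le_of_ge hx (subset_insert x D) (mem_insert x D))
      rw [dist_self] at this
      exact this.not_ge hε.le
  infer_instance

theorem TopologicalSpace.IsSeparable.countable_of_forall_subset_isClosed {D : Set X}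
    (hs : IsSeparable D) (hD : ∀ S ⊆ D, IsClosed S) : D.Countable := by
  have : SeparableSpace D := (separableSpace_coe_iff_isSeparable _).2 hs
  have : DiscreteTopology D := discreteTopology_iff_forall_isClosed.2 fun S => by
    have := (hD (Subtype.val '' S) (by rintro _ ⟨x, -, rfl⟩; exact x.2)).preimage
      (continuous_subtype_val (p := fun x => x ∈ D))
    rwa [preimage_image_eq _ Subtype.val_injective] at this
  exact separableSpace_iff_countable.1 ‹SeparableSpace D›

open Cardinal in
theorem IsLocallySeparable.not_normalSpace_lambdaSubspace (hloc : IsLocallySeparable X)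
    (hsep : ¬ SeparableSpace X) : ¬ NormalSpace (lambdaSubspace X) := by
  let _ := metrizableSpaceMetric X
  obtain ⟨D, hDc, hD⟩ := exists_uncountable_forall_subset_isClosed hsep
  let W := (ℵ_ 1 : Cardinal).ord.ToType
  have hWc : #W = ℵ_ 1 := mk_ord_toType _
  have hW : ∀ α : W, (Iio α).Countable := fun α => by
    rw [← le_aleph0_iff_set_countable, ← lt_aleph_one_iff]
    simpa [hWc] using mk_Iio_lt α (by simp [W])
  have : Uncountable W := by
    rw [← aleph0_lt_mk_iff, hWc]
    exact aleph0_lt_aleph_one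
  have hle : #(W × ℕ) ≤ #D := by
    have h : #(W × ℕ) = ℵ_ 1 := by
      rw [mk_prod, hWc]
      simp
    rw [h, aleph_one_le_iff, aleph0_lt_mk_iff]
    exact not_countable_iff.1 (mt countable_coe_iff.1 hDc)
  obtain ⟨j⟩ := hle
  let x : W × ℕ → X := fun d => j d
  have hxi : Function.Injective x := Subtype.val_injective.comp j.injective
  have hxD : ∀ S, x '' S ⊆ D := by
    rintro S _ ⟨d, -, rfl⟩
    exact (j d).2
  refine not_normalSpace_of_isOpen hW isOpen_lambdaSubspace
    (fun d => (stoneCechUnit (x d) : StoneCech X)) ?_ ?_ ?_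
  · intro S T hST
    rw [← image_image stoneCechUnit x S, ← image_image stoneCechUnit x T]
    refine disjoint_closure_image_stoneCechUnit ?_
    rw [(hD _ (hxD S)).closure_eq, (hD _ (hxD T)).closure_eq]
    exact (disjoint_image_iff hxi).2 hST
  · intro S hS
    rw [← image_image stoneCechUnit x S]
    exact hloc.closure_image_subset_lambdaSubspace (hS.image x).isSeparable
  · intro p hp
    obtain ⟨U, -, hU, hpU⟩ := mem_lambdaSubspace.1 hp
    -- The trace of this neighbourhood on `X` lies in the separable set `closure U`, which meets the
    -- closed discrete set in a countable set.
    refine ⟨_, isOpen_interior, hpU, ?_⟩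
    have h : (closure U ∩ range x).Countable :=
      (hU.closure.mono inter_subset_left).countable_of_forall_subset_isClosed (fun S hS =>
        hD S fun z hz => by
          obtain ⟨d, rfl⟩ := (hS hz).2
          exact (j d).2)
    refine (h.preimage_of_injOn hxi.injOn).mono fun d hd => ?_
    exact ⟨stoneCechUnit_mem_closure_image.1 (interior_subset hd), mem_range_self d⟩

end Metrizable

theorem theorem4p1 (X : Type*) [TopologicalSpace X] [TopologicalSpace.MetrizableSpace X]
    (hloc : IsLocallySeparable X) (hsep : ¬ TopologicalSpace.SeparableSpace X) :
    Nonempty (WeakDual.characterSpace ℂ (separableSupportAlgebra X) ≃ₜ lambdaSubspace X) ∧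
      LocallyCompactSpace (WeakDual.characterSpace ℂ (separableSupportAlgebra X)) ∧
      CountablyCompactSpace (WeakDual.characterSpace ℂ (separableSupportAlgebra X)) ∧
      ¬ NormalSpace (WeakDual.characterSpace ℂ (separableSupportAlgebra X)) := by
  let h := lambdaHomeomorph (X := X)
  have := locallyCompactSpace_lambdaSubspace (X := X)
  refine ⟨⟨h.symm⟩, h.symm.isOpenEmbedding.locallyCompactSpace, ⟨?_⟩, fun hn => ?_⟩
  · rw [← h.surjective.range_eq, ← image_univ]
    exact hloc.countablyCompactSpace_lambdaSubspace.isCountablyCompact_univ.image h.continuous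
  · exact hloc.not_normalSpace_lambdaSubspace hsep h.symm.normalSpace
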